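/- Let $n\ge 2$ and let $p=\frac{n+1}{n-1}$ be the Glassey exponent. Let $\mu:[0,\infty)\to[0,\infty)$ be a modulus of continuity, i.e. a continuous, concave, increasing (in the weak sense, non-decreasing) function with $\mu(0)=0$. Assume that 1. the limit $\lim_{\tau\to 0+}\mu(\tau)\log\frac1\tau=C_{\mathrm{Gla}}$ exists in $(0,+\infty]$; 2. if $C_{\mathrm{Gla}}<+\infty$, then there is $\tau_0>0$ such that $\tau\mapsto\mu(\tau)\log\frac1\tau$ is non-decreasing (possibly constant) on $(0,\tau_0]$; 3. the function $g(\tau)=\tau\,[\mu(\tau)]^{1/p}$ is convex on $[0,\infty)$. Let $R>0$, and let $u_0\in H^1(\mathbb R^n)$ and $u_1\in L^2(\mathbb R^n)$ be non-negative (a.e.), with supports contained in $B_R=\{|x|\le R\}$, and with $u_1$ not identically zero (a.e.). Consider the Cauchy problem $$u_{tt}-\Delta u=|u_t|^{p}\mu(|u_t|)\quad (x\in\mathbb R^n,\ t>0),\qquad u(0,x)=u_0(x),\quad u_t(0,x)=u_1(x).$$ For $0<T\le\infty$, an energy solution on $[0,T)$ is a function $u\in C([0,T),H^1(\mathbb R^n))\cap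 C^1([0,T),L^2(\mathbb R^n))$ with $|u_t|^{p}\mu(|u_t|)\in L^1_{\mathrm{loc}}([0,T)\times\mathbb R^n)$ and $u(0,\cdot)=u_0$ such that $$\int_{\mathbb R^n}u_t(t,x)\phi(t,x)\,dx+\int_0^t\!\int_{\mathbb R^n}\big(\nabla u\cdot\nabla\phi-u_t\phi_t\big)(s,x)\,dx\,ds=\int_{\mathbb R^n}u_1(x)\phi(0,x)\,dx+\int_0^t\!\int_{\mathbb R^n}|u_t(s,x)|^{p}\mu(|u_t(s,x)|)\,\phi(s,x)\,dx\,ds$$ for all $\phi\in C_0^\infty([0,T)\times\mathbb R^n)$ and all $t\in[0,T)$. Then every energy solution $u$ with $\operatorname{supp}u(t,\cdot)\subset B_{R+t}$ for all $t\in(0,T)$ blows up in finite time, that is, it has finite lifespan: there is $T_*<\infty$, depending only on $n,\mu,R,u_0,u_1$, such that every energy solution on an interval $[0,T)$, $0<T\le\infty$, with $\operatorname{supp}u(t,\cdot)\subset B_{R+t}$ for all $t\in(0,T)$ satisfies $T\le T_*$. In particular no such solution is, or can be continued to be, global in time. -/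

import Mathlib

open MeasureTheory Set Filter Topology
open scoped ContDiff ENNReal

noncomputable section

/-- The Glassey exponent `(n + 1) / (n - 1)`, used for `2 ≤ n`. -/
def glasseyExponent (n : ℕ) : ℝ := ((n : ℝ) + 1) / ((n : ℝ) - 1)

/-- A modulus of continuity `[0, ∞) → [0, ∞)`: continuous, concave, increasing, zero at zero.
Only the values of `μ` on `[0, ∞)` matter; monotonicity and `μ 0 = 0` make them non-negative. -/
structure IsModulusOfContinuity (μ : ℝ → ℝ) : Prop where
  continuousOn : ContinuousOn μ (Ici 0)
  concaveOn : ConcaveOn ℝ (Ici 0) μ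
  monotoneOn : MonotoneOn μ (Ici 0)
  map_zero : μ 0 = 0

/-- The derivative nonlinearity `v ↦ |v|^p μ(|v|)` with the Glassey exponent `p`. -/
def glasseyNonlinearity (n : ℕ) (μ : ℝ → ℝ) (v : ℝ) : ℝ :=
  |v| ^ glasseyExponent n * μ |v|

/-- `G` is the weak gradient of `f` on `ℝⁿ`: for each direction `v` and each
`ψ ∈ C_c^∞(ℝⁿ)`, `∫ f ∂_v ψ = - ∫ (G · v) ψ`. -/
def HasWeakGradient {n : ℕ} (f : EuclideanSpace ℝ (Fin n) → ℝ)
    (G : EuclideanSpace ℝ (Fin n) → EuclideanSpace ℝ (Fin n)) : Prop :=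
  ∀ ψ : EuclideanSpace ℝ (Fin n) → ℝ, ContDiff ℝ ∞ ψ → HasCompactSupport ψ →
    ∀ v : EuclideanSpace ℝ (Fin n),
      ∫ x, f x * fderiv ℝ ψ x v = - ∫ x, inner ℝ (G x) v * ψ x

/-- Membership in the Sobolev space `H¹(ℝⁿ)`. -/
def MemH1 {n : ℕ} (f : EuclideanSpace ℝ (Fin n) → ℝ) : Prop :=
  MemLp f 2 volume ∧
    ∃ G : EuclideanSpace ℝ (Fin n) → EuclideanSpace ℝ (Fin n),
      MemLp G 2 volume ∧ HasWeakGradient f G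

/-- The essential support of `f` lies in the (closed) ball of radius `r` around the origin. -/
def EssSupportedInBall {n : ℕ} (f : EuclideanSpace ℝ (Fin n) → ℝ) (r : ℝ) : Prop :=
  ∀ᵐ x ∂(volume : Measure (EuclideanSpace ℝ (Fin n))), r < ‖x‖ → f x = 0

/-- The time interval `[0, T)`, where `T = ∞` is allowed. -/
def timeInterval (T : EReal) : Set ℝ := {t : ℝ | 0 ≤ t ∧ (t : EReal) < T}

/-- `f` is a continuous curve with values in `L²(ℝⁿ)` on the set of times `I`. -/
def ContinuousInL2 {n : ℕ} {F : Type*} [NormedAddCommGroup F] (I : Set ℝ)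
    (f : ℝ → EuclideanSpace ℝ (Fin n) → F) : Prop :=
  (∀ t ∈ I, MemLp (f t) 2 volume) ∧
    ∀ t ∈ I, Tendsto (fun s : ℝ => eLpNorm (fun x => f s x - f t x) 2 volume) (𝓝[I] t) (𝓝 0)

/-- At each time of `I`, the curve `u` is differentiable in `L²(ℝⁿ)` (one-sidedly at an end point
of `I`) with derivative `ut`. -/
def HasTimeDerivInL2 {n : ℕ} (I : Set ℝ) (u ut : ℝ → EuclideanSpace ℝ (Fin n) → ℝ) : Prop :=
  ∀ t ∈ I, Tendsto
    (fun s : ℝ => eLpNorm (fun x => (s - t)⁻¹ * (u s x - u t x) - ut t x) 2 volume)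
    (𝓝[I \ {t}] t) (𝓝 0)

/-- Test functions in `C_0^∞([0, T) × ℝⁿ)`, given as the restrictions to `[0, T) × ℝⁿ` of smooth
compactly supported functions on `ℝ × ℝⁿ` that vanish near `[T, ∞) × ℝⁿ`. -/
structure IsSpaceTimeTest {n : ℕ} (T : EReal)
    (φ : ℝ × EuclideanSpace ℝ (Fin n) → ℝ) : Prop where
  contDiff : ContDiff ℝ ∞ φ
  hasCompactSupport : HasCompactSupport φ
  time_lt : ∀ z ∈ tsupport φ, (z.1 : EReal) < T

/-- `u`, with time derivative `ut` and spatial gradient `Du`, is an energy solution on `[0, T)` of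
`u_tt - Δu = |u_t|^p μ(|u_t|)`, `u(0) = u₀`, `u_t(0) = u₁`, where `p` is the Glassey exponent:
`u ∈ C([0,T), H¹) ∩ C¹([0,T), L²)`, the nonlinear term is in `L¹_loc([0,T) × ℝⁿ)`, and the
integral relation holds. (At `t = 0` the integral relation says that `u_t(0) = u₁`.) -/
structure IsEnergySolution (n : ℕ) (μ : ℝ → ℝ) (u₀ u₁ : EuclideanSpace ℝ (Fin n) → ℝ)
    (T : EReal) (u ut : ℝ → EuclideanSpace ℝ (Fin n) → ℝ)
    (Du : ℝ → EuclideanSpace ℝ (Fin n) → EuclideanSpace ℝ (Fin n)) : Prop where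
  continuous_u : ContinuousInL2 (timeInterval T) u
  weakGradient : ∀ t ∈ timeInterval T, HasWeakGradient (u t) (Du t)
  continuous_Du : ContinuousInL2 (timeInterval T) Du
  timeDeriv : HasTimeDerivInL2 (timeInterval T) u ut
  continuous_ut : ContinuousInL2 (timeInterval T) ut
  locallyIntegrable : LocallyIntegrableOn
    (fun z : ℝ × EuclideanSpace ℝ (Fin n) => glasseyNonlinearity n μ (ut z.1 z.2))
    (timeInterval T ×ˢ univ) volume
  initial : u 0 =ᵐ[volume] u₀
  integral_relation : ∀ φ : ℝ × EuclideanSpace ℝ (Fin n) → ℝ, IsSpaceTimeTest T φ →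
    ∀ t ∈ timeInterval T,
      (∫ x, ut t x * φ (t, x)) +
        (∫ s in (0 : ℝ)..t, ∫ x,
          (inner ℝ (Du s x) (gradient (fun y => φ (s, y)) x)
            - ut s x * deriv (fun r => φ (r, x)) s)) =
      (∫ x, u₁ x * φ (0, x)) +
        ∫ s in (0 : ℝ)..t, ∫ x, glasseyNonlinearity n μ (ut s x) * φ (s, x)

end

/-! The solution is tested with one plane wave `e ^ (x i - t)`, a positive solution of the free wave
equation. Put `U(t) = e ^ (-t) ∫ u_t e ^ (x i)`, `V(t) = e ^ (-t) ∫ u e ^ (x i)`, and let `h` be the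
same pairing with the nonlinearity. The equation becomes `U + V = V(0) + a + ∫ h` with `V' = U - V`,
where `a = ∫ u₁ e ^ (x i) > 0`; hence `U ≥ a/2 + (1/2) ∫ h` (`half_le_of_integral_identity`).

Conversely `h` is bounded below by `U`. By finite speed of propagation everything lives in the ball
of radius `X = R + t`, where the plane wave has mass at most `M ~ X ^ ((n-1)/2)`
(`integral_exp_coord_closedBall_le`). The nonlinearity `F(τ) = τ ^ p μ(τ)` is convex, so Jensen
gives `h ≥ M F(U/M)` (`ballMass_mul_le_integral`).

For the Glassey exponent `M ^ (1-p)` is a multiple of `1/X`, and `μ(b/M) ≳ 1/log X` with `b = a/2`.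
The lower bound `G` of `U` thus satisfies `G' ≳ G ^ p / (X log X)` in integrated form. Since `p > 1`
and the primitive `log log X` is unbounded, `G` cannot exist beyond a time fixed by the data
(`exists_lifespan_bound`). -/

/-! ### Mass of a plane exponential on a ball -/

/-- A point `x` of the ball of radius `r` satisfies `x i ≤ r - ∑_{j ≠ i} (x j)² / (2 r)`; hence the
exponential of a coordinate is dominated there by a product of one-variable functions. -/
theorem exp_coord_le_prod {n : ℕ} (i : Fin n) {r : ℝ} (hr : 0 < r)
    {x : EuclideanSpace ℝ (Fin n)} (hx : x ∈ Metric.closedBall 0 r) :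
    Real.exp (x i) ≤ Real.exp (r / 2) *
      ∏ j, (if j = i then (Iic r).indicator (fun t => Real.exp (1 / 2 * t))
        else fun t => Real.exp (-(1 / (4 * r)) * t ^ 2)) (x j) := by
  have hnorm : ‖x‖ ≤ r := by simpa using hx
  have hsq : ∑ j, x j ^ 2 ≤ r ^ 2 := by
    rw [← EuclideanSpace.real_norm_sq_eq]
    gcongr
  have hxi : x i ≤ r := (le_abs_self _).trans ((PiLp.norm_apply_le x i).trans hnorm)
  rw [← Finset.mul_prod_erase _ _ (Finset.mem_univ i)]
  rw [← Finset.add_sum_erase _ _ (Finset.mem_univ i)] at hsq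
  have hprod : ∏ j ∈ Finset.univ.erase i,
      (if j = i then (Iic r).indicator (fun t => Real.exp (1 / 2 * t))
        else fun t => Real.exp (-(1 / (4 * r)) * t ^ 2)) (x j)
      = Real.exp (-(1 / (4 * r)) * ∑ j ∈ Finset.univ.erase i, x j ^ 2) := by
    rw [Finset.mul_sum, Real.exp_sum]
    refine Finset.prod_congr rfl fun j hj => ?_
    rw [if_neg (Finset.ne_of_mem_erase hj)]
  rw [hprod, if_pos rfl, indicator_of_mem (show x i ∈ Iic r from hxi), ← Real.exp_add,
    ← Real.exp_add, Real.exp_le_exp]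
  set q := ∑ j ∈ Finset.univ.erase i, x j ^ 2
  have hxi' : -r ≤ x i := by
    have := (PiLp.norm_apply_le x i).trans hnorm
    rw [Real.norm_eq_abs] at this
    linarith [neg_abs_le (x i)]
  -- From `q ≤ (r - x i) (r + x i)` and `r + x i ≤ 2 r`. Only half of `x i` is traded for the
  -- Gaussian; the other half keeps the factor in `x i` integrable at `-∞`.
  have h1 : q ≤ 2 * r * (r - x i) := by nlinarith
  have h2 : 1 / (4 * r) * q ≤ 1 / 2 * (r - x i) := by
    rw [div_mul_eq_mul_div, div_le_iff₀ (by positivity)]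
    linarith
  linarith

/-- The mass sits in a cap at the pole, of depth `O(1)` and width `O(√r)` in the other `n - 1`
directions. This power of `r` is what makes the Glassey exponent critical. -/
theorem integral_exp_coord_closedBall_le {n : ℕ} (i : Fin n) {r : ℝ} (hr : 0 < r) :
    ∫ x in Metric.closedBall (0 : EuclideanSpace ℝ (Fin n)) r, Real.exp (x i)
      ≤ 2 * Real.exp r * √(4 * Real.pi * r) ^ (n - 1) := by
  set f : Fin n → ℝ → ℝ := fun j => if j = i then (Iic r).indicator (fun t => Real.exp (1 / 2 * t))
        else fun t => Real.exp (-(1 / (4 * r)) * t ^ 2) with hf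
  have hfint : ∀ j, Integrable (f j) := by
    intro j
    by_cases h : j = i
    · simp only [hf, if_pos h]
      exact (integrableOn_exp_mul_Iic (by norm_num) r).integrable_indicator measurableSet_Iic
    · simp only [hf, if_neg h]
      exact integrable_exp_neg_mul_sq (by positivity)
  have hf0 : ∀ j t, 0 ≤ f j t := by
    intro j t
    by_cases h : j = i
    · simp only [hf, if_pos h]
      exact indicator_nonneg (fun _ _ => (Real.exp_pos _).le) _
    · simp only [hf, if_neg h]
      positivity
  have hmp := EuclideanSpace.volume_preserving_symm_measurableEquiv_toLp (Fin n)
  have hFint : Integrable (fun x : EuclideanSpace ℝ (Fin n) => ∏ j, f j (x j)) :=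
    hmp.integrable_comp_of_integrable (Integrable.fintype_prod hfint)
  have hF : ∫ x : EuclideanSpace ℝ (Fin n), ∏ j, f j (x j)
      = 2 * Real.exp (r / 2) * √(4 * Real.pi * r) ^ (n - 1) := by
    have h1 : ∫ x : EuclideanSpace ℝ (Fin n), ∏ j, f j (x j) = ∫ y : Fin n → ℝ, ∏ j, f j (y j) :=
      hmp.integral_comp (MeasurableEquiv.measurableEmbedding _) (fun y : Fin n → ℝ => ∏ j, f j (y j))
    rw [h1, integral_fintype_prod_volume_eq_prod, ← Finset.mul_prod_erase _ _ (Finset.mem_univ i)]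
    congr 1
    · simp only [hf, if_pos]
      rw [integral_indicator measurableSet_Iic, integral_exp_mul_Iic (by norm_num)]
      rw [one_div_mul_eq_div]; ring
    · rw [Finset.prod_congr rfl (g := fun _ => √(4 * Real.pi * r))]
      · rw [Finset.prod_const, Finset.card_erase_of_mem (Finset.mem_univ i), Finset.card_univ,
          Fintype.card_fin]
      · intro j hj
        simp only [hf, if_neg (Finset.ne_of_mem_erase hj)]
        rw [integral_gaussian]
        congr 1
        field_simp
  calc ∫ x in Metric.closedBall (0 : EuclideanSpace ℝ (Fin n)) r, Real.exp (x i)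
      ≤ ∫ x in Metric.closedBall (0 : EuclideanSpace ℝ (Fin n)) r,
          Real.exp (r / 2) * ∏ j, f j (x j) := by
        refine setIntegral_mono_on ?_ (hFint.const_mul _).integrableOn
          Metric.isClosed_closedBall.measurableSet fun x hx => exp_coord_le_prod i hr hx
        exact ContinuousOn.integrableOn_compact (isCompact_closedBall _ _)
          (by fun_prop)
    _ ≤ ∫ x : EuclideanSpace ℝ (Fin n), Real.exp (r / 2) * ∏ j, f j (x j) :=
        setIntegral_le_integral (hFint.const_mul _) (Eventually.of_forall fun x =>
          mul_nonneg (Real.exp_pos _).le (Finset.prod_nonneg fun j _ => hf0 j _))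
    _ = 2 * Real.exp r * √(4 * Real.pi * r) ^ (n - 1) := by
        rw [integral_const_mul, hF]
        have : Real.exp r = Real.exp (r / 2) * Real.exp (r / 2) := by
          rw [← Real.exp_add]; ring_nf
        rw [this]; ring

/-! ### Jensen's inequality with one-sided bounds -/

theorem ConvexOn.exists_subgradient_of_mem_interior {S : Set ℝ} {f : ℝ → ℝ} (hf : ConvexOn ℝ S f)
    {m : ℝ} (hm : m ∈ interior S) : ∃ k, ∀ y ∈ S, f m + k * (y - m) ≤ f y := by
  refine ⟨derivWithin f (Ioi m) m, fun y hy => ?_⟩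
  rcases lt_trichotomy m y with h | rfl | h
  · have := hf.rightDeriv_le_slope_of_mem_interior hm hy h
    rw [slope_def_field, le_div_iff₀ (by linarith)] at this
    linarith
  · simp
  · have := (hf.slope_le_leftDeriv_of_mem_interior hy hm h).trans
      (hf.leftDeriv_le_rightDeriv_of_mem_interior hm)
    rw [slope_def_field, div_le_iff₀ (by linarith)] at this
    linarith

/-- Jensen's inequality in perspective form: only an upper bound `M` of the total mass of the
weight `w` on `B` and a lower bound `U` of the weighted mass of `v` are needed. -/
theorem ConvexOn.mul_map_div_le_setIntegral {α : Type*} [MeasurableSpace α] {ν : Measure α}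
    {B : Set α} (hB : MeasurableSet B) {F : ℝ → ℝ}
    (hF : ConvexOn ℝ (Ici 0) F) (hF0 : F 0 = 0) (hFnn : ∀ τ, 0 ≤ τ → 0 ≤ F τ)
    {v w : α → ℝ} (hv : ∀ x, 0 ≤ v x) (hw : ∀ x, 0 ≤ w x)
    (hwi : IntegrableOn w B ν) (hvw : IntegrableOn (fun x => v x * w x) B ν)
    (hFvw : IntegrableOn (fun x => F (v x) * w x) B ν)
    {M U : ℝ} (hM : 0 < M) (hU : 0 < U) (hwM : ∫ x in B, w x ∂ν ≤ M)
    (hvU : U ≤ ∫ x in B, v x * w x ∂ν) :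
    M * F (U / M) ≤ ∫ x in B, F (v x) * w x ∂ν := by
  have hm : 0 < U / M := div_pos hU hM
  obtain ⟨k, hk⟩ := hF.exists_subgradient_of_mem_interior (m := U / M) (by rw [interior_Ici]; exact hm)
  have h0 := hk 0 (mem_Ici.2 le_rfl)
  rw [hF0] at h0
  -- The supporting line lies below `F 0 = 0` at `0` and meets `F m ≥ 0` at `m`. So its slope is
  -- nonnegative and its intercept nonpositive: exactly the signs that allow a lower bound `U` and
  -- an upper bound `M`.
  have hk0 : 0 ≤ k := by
    by_contra hneg
    have := hFnn _ hm.le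
    nlinarith
  set m := U / M with hmdef
  have hmM : M * m = U := by rw [hmdef]; field_simp
  calc M * F m = M * (F m - k * m) + k * U := by rw [← hmM]; ring
    _ ≤ (∫ x in B, w x ∂ν) * (F m - k * m) + k * ∫ x in B, v x * w x ∂ν := by
        have := mul_le_mul_of_nonneg_left hvU hk0
        have h2 : F m - k * m ≤ 0 := by linarith
        have := mul_le_mul_of_nonpos_right hwM h2
        linarith
    _ = ∫ x in B, (w x * (F m - k * m) + k * (v x * w x)) ∂ν := by
        rw [integral_add (hwi.mul_const _) (hvw.const_mul _), integral_mul_const,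
          integral_const_mul]
    _ ≤ ∫ x in B, F (v x) * w x ∂ν := by
        refine setIntegral_mono_on ((hwi.mul_const _).add (hvw.const_mul _)) hFvw hB fun x _ => ?_
        have := mul_le_mul_of_nonneg_right (hk (v x) (hv x)) (hw x)
        linarith

/-! ### Consequences of `L²` convergence -/

theorem tendsto_integral_mul_of_tendsto_eLpNorm {α ι : Type*} [MeasurableSpace α] {ν : Measure α}
    {l : Filter ι} {f : ι → α → ℝ} {g : α → ℝ} (hg : MemLp g 2 ν)
    (hf : ∀ᶠ s in l, AEStronglyMeasurable (f s) ν)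
    (h : Tendsto (fun s => eLpNorm (f s) 2 ν) l (𝓝 0)) :
    Tendsto (fun s => ∫ x, f s x * g x ∂ν) l (𝓝 0) := by
  rw [tendsto_zero_iff_enorm_tendsto_zero]
  have h0 : Tendsto (fun s => eLpNorm (f s) 2 ν * eLpNorm g 2 ν) l (𝓝 0) := by
    have := ENNReal.Tendsto.mul_const (b := eLpNorm g 2 ν) h (Or.inr hg.eLpNorm_ne_top)
    rwa [zero_mul] at this
  refine tendsto_of_tendsto_of_tendsto_of_le_of_le' tendsto_const_nhds h0
    (Eventually.of_forall fun _ => bot_le) ?_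
  filter_upwards [hf] with s hs
  refine (enorm_integral_le_lintegral_enorm _).trans ?_
  rw [← eLpNorm_one_eq_lintegral_enorm]
  have := eLpNorm_smul_le_mul_eLpNorm (p := 2) (q := 2) (r := 1) hg.1 hs
  rwa [smul_eq_mul] at this

theorem ae_eq_zero_of_tendsto_eLpNorm {α ι : Type*} [MeasurableSpace α] {ν : Measure α}
    {l : Filter ι} [l.NeBot] {f : ι → α → ℝ} {g : α → ℝ} {A : Set α} (hA : MeasurableSet A)
    (hg : AEStronglyMeasurable g ν) (hf : ∀ᶠ s in l, ∀ᵐ x ∂ν, x ∈ A → f s x = 0)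
    (h : Tendsto (fun s => eLpNorm (fun x => f s x - g x) 2 ν) l (𝓝 0)) :
    ∀ᵐ x ∂ν, x ∈ A → g x = 0 := by
  rw [← ae_restrict_iff' hA]
  change g =ᵐ[ν.restrict A] 0
  rw [← eLpNorm_eq_zero_iff (p := 2) hg.restrict two_ne_zero]
  refine le_antisymm (ge_of_tendsto h ?_) bot_le
  filter_upwards [hf] with s hs
  rw [← ae_restrict_iff' hA] at hs
  calc eLpNorm g 2 (ν.restrict A) = eLpNorm (fun x => f s x - g x) 2 (ν.restrict A) := by
        refine eLpNorm_congr_norm_ae ?_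
        filter_upwards [hs] with x hx
        rw [hx, zero_sub, norm_neg]
    _ ≤ eLpNorm (fun x => f s x - g x) 2 ν := eLpNorm_mono_measure _ Measure.restrict_le_self

/-! ### The blow-up differential inequality -/

/-- Comparison with the differential equation `H' = L' H ^ p`: the increment of `L` is bounded by
the initial value. -/
theorem mul_sub_le_rpow_of_integral_le {p b s₀ S : ℝ} (hp : 1 < p) (hb : 0 < b) (hs : s₀ ≤ S)
    {G w L : ℝ → ℝ} (hG : ContinuousOn G (Icc s₀ S)) (hw : ContinuousOn w (Icc s₀ S))
    (hw0 : ∀ s ∈ Icc s₀ S, 0 ≤ w s) (hL : ∀ s ∈ Icc s₀ S, HasDerivAt L (w s) s)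
    (hbG : ∀ s ∈ Icc s₀ S, b ≤ G s)
    (hint : ∀ t ∈ Icc s₀ S, b + ∫ s in s₀..t, w s * G s ^ p ≤ G t) :
    (p - 1) * (L S - L s₀) ≤ b ^ (1 - p) := by
  have hk : ContinuousOn (fun s => w s * G s ^ p) (Icc s₀ S) :=
    hw.mul (hG.rpow_const fun x hx => Or.inl (by linarith [hbG x hx]))
  -- `G` need not be differentiable; its minorant `H` is, with `H' = w G ^ p ≥ w H ^ p`.
  set H : ℝ → ℝ := fun t => b + ∫ s in s₀..t, w s * G s ^ p with hH
  have hHc : ContinuousOn H (Icc s₀ S) := by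
    have := intervalIntegral.continuousOn_primitive_interval (μ := volume) (a := s₀) (b := S)
      (f := fun s => w s * G s ^ p) (by rw [uIcc_of_le hs]; exact hk.integrableOn_Icc)
    rw [uIcc_of_le hs] at this
    exact continuousOn_const.add this
  have hHb : ∀ t ∈ Icc s₀ S, b ≤ H t := fun t ht => by
    have : 0 ≤ ∫ s in s₀..t, w s * G s ^ p :=
      intervalIntegral.integral_nonneg ht.1 fun s hs' =>
        have hs'' : s ∈ Icc s₀ S := ⟨hs'.1, hs'.2.trans ht.2⟩
        mul_nonneg (hw0 s hs'') (Real.rpow_nonneg (hb.le.trans (hbG s hs'')) _)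
    simp only [hH]; linarith
  have hHd : ∀ t ∈ Ioo s₀ S, HasDerivAt H (w t * G t ^ p) t := fun t ht => by
    refine HasDerivAt.const_add _ ?_
    refine intervalIntegral.integral_hasDerivAt_right ?_ ?_ ?_
    · refine ContinuousOn.intervalIntegrable ?_
      rw [uIcc_of_le ht.1.le]
      exact hk.mono (Icc_subset_Icc_right ht.2.le)
    · exact (hk.mono Ioo_subset_Icc_self).stronglyMeasurableAtFilter isOpen_Ioo t ht
    · exact hk.continuousAt (Icc_mem_nhds ht.1 ht.2)
  -- The derivative is `(p - 1) w (1 - G ^ p H ^ (-p))`, nonpositive because `H ≤ G`.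
  have hanti : AntitoneOn (fun t => H t ^ (1 - p) + (p - 1) * L t) (Icc s₀ S) := by
    refine antitoneOn_of_hasDerivWithinAt_nonpos (convex_Icc _ _)
      (f' := fun t => (w t * G t ^ p) * (1 - p) * H t ^ (1 - p - 1) + (p - 1) * w t) ?_ ?_ ?_
    · refine (hHc.rpow_const fun x hx => Or.inl (by linarith [hHb x hx])).add ?_
      exact continuousOn_const.mul fun x hx => (hL x hx).continuousAt.continuousWithinAt
    · intro x hx
      rw [interior_Icc] at hx
      have hx' := Ioo_subset_Icc_self hx
      exact (((hHd x hx).rpow_const (Or.inl (by linarith [hHb x hx']))).add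
        ((hL x hx').const_mul _)).hasDerivWithinAt
    · intro x hx
      rw [interior_Icc] at hx
      have hx' := Ioo_subset_Icc_self hx
      have hHx : 0 < H x := hb.trans_le (hHb x hx')
      have h1 : H x ^ p ≤ G x ^ p := Real.rpow_le_rpow hHx.le (hint x hx') (by linarith)
      have h2 : H x ^ p * H x ^ (1 - p - 1) = 1 := by
        rw [← Real.rpow_add hHx]; simp
      have h3 : 1 ≤ G x ^ p * H x ^ (1 - p - 1) := by
        have := mul_le_mul_of_nonneg_right h1 (Real.rpow_nonneg hHx.le (1 - p - 1))
        rwa [h2] at this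
      have h4 := mul_le_mul_of_nonneg_left h3 (mul_nonneg (sub_nonneg.2 hp.le) (hw0 x hx'))
      nlinarith
  have h := hanti (left_mem_Icc.2 hs) (right_mem_Icc.2 hs) hs
  have h0 : H s₀ = b := by simp [hH]
  have h1 : 0 ≤ H S ^ (1 - p) :=
    Real.rpow_nonneg (hb.le.trans (hHb S (right_mem_Icc.2 hs))) _
  simp only [h0] at h
  linarith

theorem one_lt_glasseyExponent {n : ℕ} (hn : 2 ≤ n) : 1 < glasseyExponent n := by
  have : (2 : ℝ) ≤ n := by exact_mod_cast hn
  rw [glasseyExponent, lt_div_iff₀ (by linarith)]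
  linarith

theorem IsModulusOfContinuity.nonneg {μ : ℝ → ℝ} (hμ : IsModulusOfContinuity μ) {τ : ℝ}
    (hτ : 0 ≤ τ) : 0 ≤ μ τ := by
  rw [← hμ.map_zero]
  exact hμ.monotoneOn (mem_Ici.2 le_rfl) hτ hτ

/-- Any real number strictly between `0` and `C` serves, also when `C = ⊤`. -/
theorem exists_eventually_le_mul_log {μ : ℝ → ℝ} {C : EReal} (hC : 0 < C)
    (hlim : Tendsto (fun τ : ℝ => ((μ τ * Real.log (1 / τ) : ℝ) : EReal)) (𝓝[>] 0) (𝓝 C)) :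
    ∃ c : ℝ, 0 < c ∧ ∀ᶠ τ in 𝓝[>] (0 : ℝ), c ≤ μ τ * Real.log (1 / τ) := by
  obtain ⟨c, hc0, hcC⟩ := EReal.lt_iff_exists_real_btwn.1 hC
  refine ⟨c, by exact_mod_cast hc0, ?_⟩
  filter_upwards [hlim.eventually (lt_mem_nhds hcC)] with τ hτ
  exact_mod_cast hτ.le

/-- A bound, up to a constant, of the mass of `e ^ (x i - t)` on the ball of radius `X = R + t`. -/
noncomputable def ballMass (n : ℕ) (A X : ℝ) : ℝ := A * √(4 * Real.pi * X) ^ (n - 1)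

theorem ballMass_pos {n : ℕ} {A X : ℝ} (hA : 0 < A) (hX : 0 < X) : 0 < ballMass n A X := by
  have := Real.pi_pos
  unfold ballMass
  positivity

/-- Criticality of the exponent: `(n - 1)/2 * (1 - p) = -1`. -/
theorem ballMass_rpow {n : ℕ} (hn : 2 ≤ n) {A X : ℝ} (hA : 0 < A) (hX : 0 < X) :
    ballMass n A X ^ (1 - glasseyExponent n) =
      A ^ (1 - glasseyExponent n) / (4 * Real.pi * X) := by
  have hn' : (2 : ℝ) ≤ n := by exact_mod_cast hn
  have hpi := Real.pi_pos
  have hy : 0 < 4 * Real.pi * X := by positivity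
  rw [ballMass, Real.mul_rpow hA.le (by positivity), div_eq_mul_inv, Real.sqrt_eq_rpow,
    ← Real.rpow_natCast, ← Real.rpow_mul hy.le, ← Real.rpow_mul hy.le, ← Real.rpow_neg_one]
  congr 2
  rw [Nat.cast_sub (by omega), glasseyExponent]
  have : (n : ℝ) - 1 ≠ 0 := by linarith
  field_simp
  push_cast
  ring

theorem tendsto_ballMass {n : ℕ} (hn : 2 ≤ n) {A : ℝ} (hA : 0 < A) :
    Tendsto (ballMass n A) atTop atTop := by
  have hpi := Real.pi_pos
  unfold ballMass
  refine Tendsto.const_mul_atTop hA ((tendsto_pow_atTop (by omega)).comp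
    (Real.tendsto_sqrt_atTop.comp (tendsto_id.const_mul_atTop (by positivity))))

/-- The power contributes `1/X`, which alone would give a logarithmic divergence; the modulus costs
one factor `log X`, and `1/(X log X)` is still not integrable at infinity. -/
theorem exists_eventually_le_ballMass_rpow_mul {n : ℕ} (hn : 2 ≤ n) {μ : ℝ → ℝ}
    (hμ : IsModulusOfContinuity μ) {C : EReal} (hC : 0 < C)
    (hlim : Tendsto (fun τ : ℝ => ((μ τ * Real.log (1 / τ) : ℝ) : EReal)) (𝓝[>] 0) (𝓝 C))
    {A b : ℝ} (hA : 0 < A) (hb : 0 < b) :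
    ∃ κ : ℝ, 0 < κ ∧ ∀ᶠ X in atTop, κ / (X * Real.log X) ≤
      ballMass n A X ^ (1 - glasseyExponent n) * μ (b / ballMass n A X) := by
  obtain ⟨c, hc, hμc⟩ := exists_eventually_le_mul_log hC hlim
  have hpi := Real.pi_pos
  have hn0 : (0 : ℝ) < n := by exact_mod_cast (by omega : 0 < n)
  have hAp : 0 < A ^ (1 - glasseyExponent n) := Real.rpow_pos_of_pos hA _
  refine ⟨A ^ (1 - glasseyExponent n) / (4 * Real.pi) * (c / n), by positivity, ?_⟩
  have htend : Tendsto (fun X => b / ballMass n A X) atTop (𝓝[>] 0) := by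
    refine tendsto_nhdsWithin_iff.2 ⟨(tendsto_ballMass hn hA).const_div_atTop b, ?_⟩
    filter_upwards [eventually_gt_atTop 0] with X hX
    exact div_pos hb (ballMass_pos hA hX)
  filter_upwards [htend.eventually hμc, eventually_gt_atTop 1,
    eventually_ge_atTop (A / b * (4 * Real.pi) ^ (n - 1))] with X hX hX1 hXA
  have hX0 : 0 < X := by linarith
  have hM := ballMass_pos (n := n) hA hX0
  have hlogX : 0 < Real.log X := Real.log_pos hX1
  -- The mass is bounded crudely by a power of `X`: only its logarithm enters, so the exponent
  -- affects just the constant.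
  have hlog : Real.log (1 / (b / ballMass n A X)) ≤ n * Real.log X := by
    rw [one_div_div, ← Real.log_pow]
    refine Real.log_le_log (by positivity) ?_
    have h1 : 1 ≤ 4 * Real.pi * X := by
      have := Real.pi_gt_three
      nlinarith
    have h2 : √(4 * Real.pi * X) ≤ 4 * Real.pi * X := by
      rw [Real.sqrt_le_left (by linarith)]
      nlinarith
    calc ballMass n A X / b ≤ A * (4 * Real.pi * X) ^ (n - 1) / b := by
          unfold ballMass; gcongr
      _ = A / b * (4 * Real.pi) ^ (n - 1) * X ^ (n - 1) := by rw [mul_pow]; ring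
      _ ≤ X * X ^ (n - 1) := by gcongr
      _ = X ^ n := by rw [← pow_succ']; congr 1; omega
  have hμ0 : 0 ≤ μ (b / ballMass n A X) := hμ.nonneg (by positivity)
  have hμX : c / n / Real.log X ≤ μ (b / ballMass n A X) := by
    rw [div_div, div_le_iff₀ (by positivity)]
    exact hX.trans (mul_le_mul_of_nonneg_left hlog hμ0)
  rw [ballMass_rpow hn hA hX0]
  calc A ^ (1 - glasseyExponent n) / (4 * Real.pi) * (c / n) / (X * Real.log X)
      = A ^ (1 - glasseyExponent n) / (4 * Real.pi * X) * (c / n / Real.log X) := by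
        field_simp
    _ ≤ _ := by gcongr

/-- Upper bound of the lifespan of the functional `U`. -/
theorem exists_lifespan_bound {n : ℕ} (hn : 2 ≤ n) {μ : ℝ → ℝ}
    (hμ : IsModulusOfContinuity μ) {C : EReal} (hC : 0 < C)
    (hlim : Tendsto (fun τ : ℝ => ((μ τ * Real.log (1 / τ) : ℝ) : EReal)) (𝓝[>] 0) (𝓝 C))
    {A b R : ℝ} (hA : 0 < A) (hb : 0 < b) (hR : 0 < R) :
    ∃ Tmax : ℝ, ∀ (S : ℝ) (U h : ℝ → ℝ), 0 ≤ S → IntervalIntegrable h volume 0 S →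
      (∀ s, 0 ≤ s → 0 ≤ h s) →
      (∀ t ∈ Icc 0 S, b + (1 / 2) * ∫ s in (0 : ℝ)..t, h s ≤ U t) →
      (∀ᵐ s, s ∈ Ioc 0 S → ballMass n A (R + s) *
        glasseyNonlinearity n μ (U s / ballMass n A (R + s)) ≤ h s) → S ≤ Tmax := by
  obtain ⟨κ, hκ, hev⟩ := exists_eventually_le_ballMass_rpow_mul hn hμ hC hlim hA hb
  obtain ⟨X₀, hX₀⟩ := eventually_atTop.1 hev
  set p := glasseyExponent n with hpdef
  have hp : 1 < p := one_lt_glasseyExponent hn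
  -- Beyond `X₀` the weight bound holds; the `2` makes `R + s > 1`, so that the logarithm is
  -- positive.
  set s₀ : ℝ := max X₀ 2 with hs₀
  have hs₀2 : 2 ≤ s₀ := le_max_right _ _
  set L : ℝ → ℝ := fun s => κ / 2 * Real.log (Real.log (R + s)) with hL
  have hLtop : Tendsto L atTop atTop :=
    (Real.tendsto_log_atTop.comp (Real.tendsto_log_atTop.comp
      (tendsto_atTop_add_const_left _ R tendsto_id))).const_mul_atTop (by positivity)
  obtain ⟨T₁, hT₁⟩ := eventually_atTop.1
    (hLtop.eventually (eventually_gt_atTop (b ^ (1 - p) / (p - 1) + L s₀)))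
  refine ⟨max s₀ T₁, fun S U h hS hh hh0 hU hJ => ?_⟩
  by_contra! hlt
  have hsS : s₀ ≤ S := (le_max_left _ _).trans hlt.le
  have hLS := hT₁ S ((le_max_right _ _).trans hlt.le)
  set w : ℝ → ℝ := fun s => κ / 2 / ((R + s) * Real.log (R + s)) with hw
  have hpos : ∀ s ∈ Icc s₀ S, 0 < Real.log (R + s) := fun s hs =>
    Real.log_pos (by linarith [hs.1])
  have hposX : ∀ s ∈ Icc s₀ S, 0 < R + s := fun s hs => by linarith [hs.1]
  -- The comparison runs on this continuous minorant, as no regularity of `U` is assumed.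
  set G : ℝ → ℝ := fun t => b + (1 / 2) * ∫ s in (0 : ℝ)..t, h s with hG
  have hN0 : ∀ t, 0 ≤ t → 0 ≤ ∫ s in (0 : ℝ)..t, h s := fun t ht =>
    intervalIntegral.integral_nonneg ht fun s hs => hh0 s hs.1
  have hGb : ∀ t, 0 ≤ t → b ≤ G t := fun t ht => by
    have := hN0 t ht
    simp only [hG]; linarith
  have hGc : ContinuousOn G (Icc s₀ S) := by
    have := intervalIntegral.continuousOn_primitive_interval (μ := volume) (a := 0) (b := S)
      (f := h) (by
        rw [uIcc_of_le hS]
        exact (intervalIntegrable_iff_integrableOn_Icc_of_le hS).1 hh)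
    rw [uIcc_of_le hS] at this
    exact continuousOn_const.add (continuousOn_const.mul
      (this.mono (Icc_subset_Icc_left (by linarith))))
  have hwc : ContinuousOn w (Icc s₀ S) := by
    refine continuousOn_const.div ?_ fun s hs => (mul_pos (hposX s hs) (hpos s hs)).ne'
    exact (continuousOn_const.add continuousOn_id).mul
      (ContinuousOn.log (continuousOn_const.add continuousOn_id) fun s hs => (hposX s hs).ne')
  have key := mul_sub_le_rpow_of_integral_le (L := L) hp hb hsS hGc hwc
    (fun s hs => by
      have := mul_pos (hposX s hs) (hpos s hs)
      simp only [hw]; positivity)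
    (fun s hs => by
      have h1 := ((((hasDerivAt_id s).const_add R).log (hposX s hs).ne').log
        (hpos s hs).ne').const_mul (κ / 2)
      refine h1.congr_deriv ?_
      simp only [hw, id]
      rw [div_div, mul_one_div])
    (fun s hs => hGb s (by linarith [hs.1]))
    (fun t ht => by
      have ht0 : 0 ≤ t := by linarith [ht.1]
      have hi0t : IntervalIntegrable h volume 0 t :=
        hh.mono_set (by rw [uIcc_of_le hS, uIcc_of_le ht0]; exact Icc_subset_Icc_right ht.2)
      have hi0s : IntervalIntegrable h volume 0 s₀ :=
        hh.mono_set (by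
          rw [uIcc_of_le hS, uIcc_of_le (by linarith)]; exact Icc_subset_Icc_right hsS)
      have hist : IntervalIntegrable h volume s₀ t := hi0s.symm.trans hi0t
      have hadd := intervalIntegral.integral_add_adjacent_intervals hi0s hist
      have hle : ∫ s in s₀..t, w s * G s ^ p ≤ ∫ s in s₀..t, (1 / 2) * h s := by
        refine intervalIntegral.integral_mono_ae_restrict ht.1 ?_ (hist.const_mul _) ?_
        · refine ContinuousOn.intervalIntegrable ?_
          rw [uIcc_of_le ht.1]
          refine (hwc.mul (hGc.rpow_const fun x hx => Or.inl ?_)).mono (Icc_subset_Icc_right ht.2)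
          linarith [hGb x (by linarith [hx.1])]
        · rw [EventuallyLE, ae_restrict_iff' measurableSet_Icc]
          filter_upwards [hJ] with s hs hst
          have hs' : s ∈ Icc s₀ S := ⟨hst.1, hst.2.trans ht.2⟩
          have hs0 : 0 < s := by linarith [hst.1]
          have hGU : G s ≤ U s := hU s ⟨hs0.le, hs'.2⟩
          have hGs : b ≤ G s := hGb s hs0.le
          have hM := ballMass_pos (n := n) hA (hposX s hs')
          have hstep := hs ⟨hs0, hs'.2⟩
          have hX := hX₀ (R + s) (by
            have := le_max_left X₀ 2
            linarith [hst.1])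
          set M := ballMass n A (R + s)
          have hUM : 0 < U s / M := div_pos (by linarith) hM
          -- Since `U s ≥ G s ≥ b`, monotonicity replaces `μ (U s / M)` by `μ (b / M)`, which no
          -- longer depends on the unknown.
          have hF : M ^ (1 - p) * μ (b / M) * G s ^ p ≤
              M * glasseyNonlinearity n μ (U s / M) := by
            rw [glasseyNonlinearity, abs_of_pos hUM, ← hpdef,
              Real.div_rpow (by linarith) hM.le, Real.rpow_sub hM, Real.rpow_one]
            have h1 : μ (b / M) ≤ μ (U s / M) := by
              refine hμ.monotoneOn (mem_Ici.2 (by positivity)) (mem_Ici.2 hUM.le) ?_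
              gcongr
              linarith
            have h2 : G s ^ p ≤ U s ^ p := Real.rpow_le_rpow (by linarith) hGU (by linarith)
            have h3 : 0 ≤ μ (b / M) := hμ.nonneg (by positivity)
            have h4 : 0 ≤ G s ^ p := Real.rpow_nonneg (by linarith) _
            have h5 : 0 ≤ M / M ^ p := div_nonneg hM.le (Real.rpow_nonneg hM.le _)
            have h6 : 0 ≤ M / M ^ p * μ (U s / M) := mul_nonneg h5 (h3.trans h1)
            calc M / M ^ p * μ (b / M) * G s ^ p ≤ M / M ^ p * μ (U s / M) * U s ^ p := by
                  gcongr
              _ = M * (U s ^ p / M ^ p * μ (U s / M)) := by ring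
          have hwG := mul_le_mul_of_nonneg_right hX
            (Real.rpow_nonneg (hb.le.trans hGs) p)
          have : w s * G s ^ p = 1 / 2 * (κ / ((R + s) * Real.log (R + s)) * G s ^ p) := by
            simp only [hw]; ring
          rw [this]
          linarith
      rw [intervalIntegral.integral_const_mul] at hle
      have := hN0 s₀ (by linarith)
      simp only [hG]
      linarith)
  have hp1 : 0 < p - 1 := by linarith
  have : L S - L s₀ ≤ b ^ (1 - p) / (p - 1) := by
    rw [le_div_iff₀ hp1]; linarith
  linarith

/-- On the half-line the nonlinearity is the `p`-th power of the nonnegative convex function `τ μ(τ)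
^ (1/p)`, and `p ≥ 1`. -/
theorem convexOn_glasseyNonlinearity {n : ℕ} (hn : 2 ≤ n) {μ : ℝ → ℝ}
    (hμ : IsModulusOfContinuity μ)
    (hconv : ConvexOn ℝ (Ici 0) (fun τ : ℝ => τ * μ τ ^ (1 / glasseyExponent n))) :
    ConvexOn ℝ (Ici 0) (glasseyNonlinearity n μ) := by
  have hp := one_lt_glasseyExponent hn
  have hnn : ∀ τ ∈ Ici (0 : ℝ), 0 ≤ τ * μ τ ^ (1 / glasseyExponent n) := fun τ hτ =>
    mul_nonneg hτ (Real.rpow_nonneg (hμ.nonneg hτ) _)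
  have heq : ∀ τ ∈ Ici (0 : ℝ),
      (τ * μ τ ^ (1 / glasseyExponent n)) ^ glasseyExponent n = glasseyNonlinearity n μ τ := by
    intro τ hτ
    rw [glasseyNonlinearity, abs_of_nonneg hτ, Real.mul_rpow hτ
      (Real.rpow_nonneg (hμ.nonneg hτ) _), ← Real.rpow_mul (hμ.nonneg hτ),
      one_div_mul_cancel (by linarith), Real.rpow_one]
  refine ⟨convex_Ici 0, fun x hx y hy a b ha hb hab => ?_⟩
  have hz : a • x + b • y ∈ Ici (0 : ℝ) := convex_Ici 0 hx hy ha hb hab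
  rw [← heq x hx, ← heq y hy, ← heq _ hz]
  exact (Real.rpow_le_rpow (hnn _ hz) (hconv.2 hx hy ha hb hab) (by linarith)).trans
    ((convexOn_rpow hp.le).2 (hnn x hx) (hnn y hy) ha hb hab)

theorem MemLp.integrable_mul_of_two {α : Type*} [MeasurableSpace α] {ν : Measure α} {f g : α → ℝ}
    (hf : MemLp f 2 ν) (hg : MemLp g 2 ν) : Integrable (fun x => f x * g x) ν :=
  MemLp.integrable_mul (p := 2) (q := 2) hf hg

/-! ### Truncated exponentials and weak integration by parts -/

/-- Agreement near each point of the closed ball, boundary included, lets derivatives be computed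
there too. -/
theorem exists_contDiff_eventuallyEq_exp_coord {n : ℕ} (i : Fin n) {r : ℝ} (hr : 0 < r) :
    ∃ Φ : EuclideanSpace ℝ (Fin n) → ℝ, ContDiff ℝ ∞ Φ ∧ HasCompactSupport Φ ∧ (∀ x, 0 ≤ Φ x) ∧
      ∀ x, ‖x‖ ≤ r → Φ =ᶠ[𝓝 x] fun y => Real.exp (y i) := by
  let ρ : ContDiffBump (0 : EuclideanSpace ℝ (Fin n)) := ⟨r + 1, r + 2, by linarith, by linarith⟩
  refine ⟨fun x => ρ x * Real.exp (x i), ?_, ρ.hasCompactSupport.mul_right, fun x =>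
    mul_nonneg ρ.nonneg (Real.exp_pos _).le, fun x hx => ?_⟩
  · exact ρ.contDiff.mul (by fun_prop)
  · have hx' : Metric.ball (0 : EuclideanSpace ℝ (Fin n)) (r + 1) ∈ 𝓝 x :=
      Metric.isOpen_ball.mem_nhds (by simpa using (by linarith : ‖x‖ < r + 1))
    filter_upwards [hx'] with y hy
    rw [ρ.one_of_mem_closedBall (Metric.ball_subset_closedBall hy), one_mul]

theorem HasWeakGradient.integral_inner_gradient {n : ℕ} {f : EuclideanSpace ℝ (Fin n) → ℝ}
    {G : EuclideanSpace ℝ (Fin n) → EuclideanSpace ℝ (Fin n)} (h : HasWeakGradient f G)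
    (hG : MemLp G 2 volume) {Φ : EuclideanSpace ℝ (Fin n) → ℝ} (hΦ : ContDiff ℝ ∞ Φ)
    (hΦc : HasCompactSupport Φ) :
    ∫ x, inner ℝ (G x) (gradient Φ x) =
      - ∑ j, ∫ x, f x * fderiv ℝ (fun y => fderiv ℝ Φ y (EuclideanSpace.single j 1)) x
        (EuclideanSpace.single j 1) := by
  have hd : ∀ j : Fin n, ContDiff ℝ ∞ fun y => fderiv ℝ Φ y (EuclideanSpace.single j 1) := fun j =>
    (hΦ.fderiv_right (m := ∞) (by simp)).clm_apply contDiff_const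
  have hdc : ∀ j : Fin n,
      HasCompactSupport fun y => fderiv ℝ Φ y (EuclideanSpace.single j 1) := fun j =>
    hΦc.fderiv_apply ℝ _
  have hsum : ∀ x, inner ℝ (G x) (gradient Φ x) =
      ∑ j, inner ℝ (G x) (EuclideanSpace.single j 1) *
        fderiv ℝ Φ x (EuclideanSpace.single j 1) := by
    intro x
    rw [← (EuclideanSpace.basisFun (Fin n) ℝ).sum_inner_mul_inner]
    refine Finset.sum_congr rfl fun j _ => ?_
    rw [EuclideanSpace.basisFun_apply, real_inner_comm (gradient Φ x), inner_gradient_left]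
  simp_rw [hsum]
  rw [integral_finsetSum, ← Finset.sum_neg_distrib]
  · refine Finset.sum_congr rfl fun j _ => ?_
    rw [h _ (hd j) (hdc j), neg_neg]
  · intro j _
    exact MemLp.integrable_mul_of_two (hG.inner_const _)
      ((hd j).continuous.memLp_of_hasCompactSupport (hdc j))

theorem fderiv_fderiv_exp_coord {n : ℕ} (i j : Fin n) {c : ℝ} {Φ : EuclideanSpace ℝ (Fin n) → ℝ}
    {x : EuclideanSpace ℝ (Fin n)} (h : Φ =ᶠ[𝓝 x] fun y => c * Real.exp (y i)) :
    fderiv ℝ (fun y => fderiv ℝ Φ y (EuclideanSpace.single j 1)) x (EuclideanSpace.single j 1) =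
      if j = i then Φ x else 0 := by
  have hexp : ∀ (k : ℝ) (y : EuclideanSpace ℝ (Fin n)),
      fderiv ℝ (fun y : EuclideanSpace ℝ (Fin n) => k * Real.exp (y i)) y
        (EuclideanSpace.single j 1) = k * Real.exp (y i) * if j = i then 1 else 0 := by
    intro k y
    have h1 : HasFDerivAt (fun y : EuclideanSpace ℝ (Fin n) => y i)
        (EuclideanSpace.proj i : EuclideanSpace ℝ (Fin n) →L[ℝ] ℝ) y :=
      (EuclideanSpace.proj i : EuclideanSpace ℝ (Fin n) →L[ℝ] ℝ).hasFDerivAt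
    rw [(h1.exp.const_mul k).fderiv]
    simp [eq_comm]
  have h1 : (fun y => fderiv ℝ Φ y (EuclideanSpace.single j 1)) =ᶠ[𝓝 x]
      fun y => (c * if j = i then 1 else 0) * Real.exp (y i) := by
    filter_upwards [h.fderiv (𝕜 := ℝ)] with y hy
    rw [hy, hexp]; ring
  rw [h1.fderiv_eq, hexp, h.eq_of_nhds]
  split_ifs <;> simp

/-- On the ball `ΔΦ = Φ`, and outside it `f` vanishes, so the cutoff is invisible. The constant `c`
will be `e ^ (-s)`. -/
theorem HasWeakGradient.integral_inner_gradient_exp_coord {n : ℕ} (i : Fin n) {c r : ℝ}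
    {f : EuclideanSpace ℝ (Fin n) → ℝ}
    {G : EuclideanSpace ℝ (Fin n) → EuclideanSpace ℝ (Fin n)} (h : HasWeakGradient f G)
    (hf : MemLp f 2 volume) (hG : MemLp G 2 volume) (hfr : EssSupportedInBall f r)
    {Φ : EuclideanSpace ℝ (Fin n) → ℝ} (hΦ : ContDiff ℝ ∞ Φ) (hΦc : HasCompactSupport Φ)
    (hΦr : ∀ x, ‖x‖ ≤ r → Φ =ᶠ[𝓝 x] fun y => c * Real.exp (y i)) :
    ∫ x, inner ℝ (G x) (gradient Φ x) = - ∫ x, f x * Φ x := by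
  have hd : ∀ j : Fin n, ContDiff ℝ ∞ fun y => fderiv ℝ Φ y (EuclideanSpace.single j 1) := fun j =>
    (hΦ.fderiv_right (m := ∞) (by simp)).clm_apply contDiff_const
  have hdd : ∀ j : Fin n, Continuous fun x =>
      fderiv ℝ (fun y => fderiv ℝ Φ y (EuclideanSpace.single j 1)) x
        (EuclideanSpace.single j 1) := fun j =>
    (((hd j).fderiv_right (m := ∞) (by simp)).clm_apply contDiff_const).continuous
  rw [h.integral_inner_gradient hG hΦ hΦc, ← integral_finsetSum]
  · congr 1
    refine integral_congr_ae ?_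
    filter_upwards [hfr] with x hx
    rcases le_or_gt ‖x‖ r with hxr | hxr
    · simp_rw [fderiv_fderiv_exp_coord i _ (hΦr x hxr), ← Finset.mul_sum]
      simp
    · simp [hx hxr]
  · intro j _
    exact MemLp.integrable_mul_of_two hf ((hdd j).memLp_of_hasCompactSupport
      ((hΦc.fderiv_apply ℝ _).fderiv_apply ℝ _))

/-! ### Curves in `L²`: pairings and supports -/

theorem ContinuousInL2.continuousOn_integral_mul {n : ℕ} {I : Set ℝ}
    {f : ℝ → EuclideanSpace ℝ (Fin n) → ℝ} (hf : ContinuousInL2 I f)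
    {g : EuclideanSpace ℝ (Fin n) → ℝ} (hg : MemLp g 2 volume) :
    ContinuousOn (fun s => ∫ x, f s x * g x) I := by
  intro t ht
  have h := tendsto_integral_mul_of_tendsto_eLpNorm hg (l := 𝓝[I] t)
    (f := fun s x => f s x - f t x) (by
      filter_upwards [self_mem_nhdsWithin] with s hs
      exact ((hf.1 s hs).sub (hf.1 t ht)).1) (hf.2 t ht)
  have h2 : Tendsto (fun s => (∫ x, f s x * g x) - ∫ x, f t x * g x) (𝓝[I] t) (𝓝 0) := by
    refine h.congr' ?_
    filter_upwards [self_mem_nhdsWithin] with s hs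
    rw [← integral_sub (MemLp.integrable_mul_of_two (hf.1 s hs) hg)
      (MemLp.integrable_mul_of_two (hf.1 t ht) hg)]
    exact integral_congr_ae (Eventually.of_forall fun x => sub_mul _ _ _)
  exact tendsto_sub_nhds_zero_iff.1 h2

theorem HasTimeDerivInL2.hasDerivWithinAt_integral_mul {n : ℕ} {I : Set ℝ}
    {u ut : ℝ → EuclideanSpace ℝ (Fin n) → ℝ} (h : HasTimeDerivInL2 I u ut)
    (hu : ∀ t ∈ I, MemLp (u t) 2 volume) (hut : ∀ t ∈ I, MemLp (ut t) 2 volume)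
    {g : EuclideanSpace ℝ (Fin n) → ℝ} (hg : MemLp g 2 volume) {t : ℝ} (ht : t ∈ I) :
    HasDerivWithinAt (fun s => ∫ x, u s x * g x) (∫ x, ut t x * g x) I t := by
  rw [hasDerivWithinAt_iff_tendsto_slope, ← tendsto_sub_nhds_zero_iff]
  have h1 := tendsto_integral_mul_of_tendsto_eLpNorm hg (l := 𝓝[I \ {t}] t)
    (f := fun s x => (s - t)⁻¹ * (u s x - u t x) - ut t x) (by
      filter_upwards [self_mem_nhdsWithin] with s hs
      exact ((((hu s hs.1).sub (hu t ht)).const_mul _).sub (hut t ht)).1) (h t ht)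
  refine h1.congr' ?_
  filter_upwards [self_mem_nhdsWithin] with s hs
  have hs' := MemLp.integrable_mul_of_two (hu s hs.1) hg
  have ht' := MemLp.integrable_mul_of_two (hu t ht) hg
  have hst : Integrable (fun x => u s x * g x - u t x * g x) := hs'.sub ht'
  rw [slope_def_field, div_eq_inv_mul, ← integral_sub hs' ht', ← integral_const_mul,
    ← integral_sub (hst.const_mul _) (MemLp.integrable_mul_of_two (hut t ht) hg)]
  refine integral_congr_ae (Eventually.of_forall fun x => ?_)
  simp only
  ring

/-- Only difference quotients from the left are used: `u s` and `u t` with `s < t` both vanish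
outside the ball at time `t`. -/
theorem HasTimeDerivInL2.essSupportedInBall {n : ℕ} {I : Set ℝ}
    {u ut : ℝ → EuclideanSpace ℝ (Fin n) → ℝ} (h : HasTimeDerivInL2 I u ut) {R t : ℝ}
    (hI : Icc 0 t ⊆ I) (ht : 0 < t) (hut : MemLp (ut t) 2 volume)
    (hu : ∀ s ∈ Ioc 0 t, EssSupportedInBall (u s) (R + s)) :
    EssSupportedInBall (ut t) (R + t) := by
  have hsub : Ioo 0 t ⊆ I \ {t} := fun s hs => ⟨hI ⟨hs.1.le, hs.2.le⟩, hs.2.ne⟩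
  have hne : (𝓝[Ioo 0 t] t).NeBot := right_nhdsWithin_Ioo_neBot ht
  have hA : MeasurableSet {x : EuclideanSpace ℝ (Fin n) | R + t < ‖x‖} :=
    measurableSet_lt measurable_const measurable_norm
  refine ae_eq_zero_of_tendsto_eLpNorm (l := 𝓝[Ioo 0 t] t) hA hut.1 ?_
    ((h t (hI (right_mem_Icc.2 ht.le))).mono_left (nhdsWithin_mono _ hsub))
  filter_upwards [self_mem_nhdsWithin] with s hs
  filter_upwards [hu s ⟨hs.1, hs.2.le⟩, hu t ⟨ht, le_rfl⟩] with x hxs hxt hx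
  have hx' : R + t < ‖x‖ := hx
  rw [hxs (by linarith [hs.2]), hxt hx', sub_zero, mul_zero]

/-! ### Lower bound for the functional `U` -/

/-- Eliminating `U` gives `V' + 2 V = V 0 + a + N` with `N = ∫ h` nondecreasing. So up to time `t`,
`V` relaxes towards at most half of `B = V 0 + a + N t`, and `U t = B - V t` keeps the rest. -/
theorem half_le_of_integral_identity {S a : ℝ} {U V h : ℝ → ℝ}
    (ha : 0 ≤ a) (hV0 : 0 ≤ V 0) (hh : IntervalIntegrable h volume 0 S)
    (hh0 : ∀ s, 0 ≤ s → 0 ≤ h s) (hU : ContinuousOn U (Icc 0 S)) (hV : ContinuousOn V (Icc 0 S))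
    (hVd : ∀ s ∈ Ioo 0 S, HasDerivAt V (U s - V s) s)
    (hid : ∀ t ∈ Icc 0 S, U t + ∫ s in (0 : ℝ)..t, (U s - V s) = a + ∫ s in (0 : ℝ)..t, h s) :
    ∀ t ∈ Icc 0 S, a / 2 + (1 / 2) * ∫ s in (0 : ℝ)..t, h s ≤ U t := by
  intro t ht
  have hint : ∀ s ∈ Icc 0 S, ∫ r in (0 : ℝ)..s, (U r - V r) = V s - V 0 := fun s hs =>
    intervalIntegral.integral_eq_sub_of_hasDerivAt_of_le hs.1
      (hV.mono (Icc_subset_Icc_right hs.2)) (fun r hr => hVd r ⟨hr.1, hr.2.trans_le hs.2⟩)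
      (((hU.sub hV).mono (Icc_subset_Icc_right hs.2)).intervalIntegrable_of_Icc hs.1)
  set N : ℝ → ℝ := fun s => ∫ r in (0 : ℝ)..s, h r with hN
  have hUV : ∀ s ∈ Icc 0 S, U s + V s = V 0 + a + N s := fun s hs => by
    have := hid s hs
    rw [hint s hs] at this
    linarith
  have hNt : ∀ s ∈ Icc 0 t, N s ≤ N t := fun s hs => by
    refine intervalIntegral.integral_mono_interval le_rfl hs.1 hs.2 ?_ (hh.mono_set ?_)
    · rw [EventuallyLE, ae_restrict_iff' measurableSet_Ioc]
      exact Eventually.of_forall fun r hr => hh0 r hr.1.le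
    · rw [uIcc_of_le ht.1, uIcc_of_le (ht.1.trans ht.2)]
      exact Icc_subset_Icc_right ht.2
  have hN0 : 0 ≤ N t := intervalIntegral.integral_nonneg ht.1 fun s hs => hh0 s hs.1
  set B := V 0 + a + N t with hB
  have hanti : AntitoneOn (fun s => Real.exp (2 * s) * (V s - B / 2)) (Icc 0 t) := by
    refine antitoneOn_of_hasDerivWithinAt_nonpos (convex_Icc _ _)
      (f' := fun s => Real.exp (2 * s) * (N s - N t)) ?_ ?_ ?_
    · exact (by fun_prop : Continuous fun s : ℝ => Real.exp (2 * s)).continuousOn.mul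
        ((hV.mono (Icc_subset_Icc_right ht.2)).sub continuousOn_const)
    · intro s hs
      rw [interior_Icc] at hs
      have hs' : s ∈ Ioo 0 S := ⟨hs.1, hs.2.trans_le ht.2⟩
      have h1 : HasDerivAt (fun s : ℝ => Real.exp (2 * s)) (Real.exp (2 * s) * 2) s := by
        have := ((hasDerivAt_id s).const_mul 2).exp
        simpa using this
      refine ((h1.mul ((hVd s hs').sub_const (B / 2))).congr_deriv ?_).hasDerivWithinAt
      have := hUV s (Ioo_subset_Icc_self hs')
      have h2 : U s = V 0 + a + N s - V s := by linarith
      rw [h2, hB]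
      ring
    · intro s hs
      rw [interior_Icc] at hs
      exact mul_nonpos_of_nonneg_of_nonpos (Real.exp_pos _).le
        (sub_nonpos.2 (hNt s (Ioo_subset_Icc_self hs)))
  have h0 := hanti (left_mem_Icc.2 ht.1) (right_mem_Icc.2 ht.1) ht.1
  simp only [mul_zero, Real.exp_zero, one_mul] at h0
  have hexp : 1 ≤ Real.exp (2 * t) := Real.one_le_exp (by linarith [ht.1])
  have hUt := hUV t ht
  change a / 2 + 1 / 2 * N t ≤ U t
  -- Either `V t ≤ B / 2`, so `U t ≥ B / 2`, or monotonicity forces `V t ≤ V 0`, so `U t ≥ a + N t`.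
  rcases le_total (V t - B / 2) 0 with hneg | hpos
  · linarith
  · have : V t - B / 2 ≤ V 0 - B / 2 := by nlinarith
    linarith

/-! ### Testing the equation with the plane wave -/

theorem glasseyNonlinearity_abs (n : ℕ) (μ : ℝ → ℝ) (v : ℝ) :
    glasseyNonlinearity n μ |v| = glasseyNonlinearity n μ v := by
  simp [glasseyNonlinearity]

theorem glasseyNonlinearity_zero {n : ℕ} {μ : ℝ → ℝ} (hμ : IsModulusOfContinuity μ) :
    glasseyNonlinearity n μ 0 = 0 := by
  simp [glasseyNonlinearity, hμ.map_zero]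

theorem glasseyNonlinearity_nonneg {n : ℕ} {μ : ℝ → ℝ} (hμ : IsModulusOfContinuity μ) (v : ℝ) :
    0 ≤ glasseyNonlinearity n μ v :=
  mul_nonneg (Real.rpow_nonneg (abs_nonneg _) _) (hμ.nonneg (abs_nonneg _))

/-- The integral relation tested with `e ^ (-s) Φ x`, where `Φ x = e ^ (x i)` on the support of the
solution. -/
theorem IsEnergySolution.integral_identity {n : ℕ} (i : Fin n) {μ : ℝ → ℝ}
    {u₀ u₁ : EuclideanSpace ℝ (Fin n) → ℝ} {T : EReal}
    {u ut : ℝ → EuclideanSpace ℝ (Fin n) → ℝ}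
    {Du : ℝ → EuclideanSpace ℝ (Fin n) → EuclideanSpace ℝ (Fin n)}
    (hsol : IsEnergySolution n μ u₀ u₁ T u ut Du) {R S : ℝ} (hS : 0 ≤ S) (hST : (S : EReal) < T)
    (hsupp : ∀ s ∈ Icc 0 S, EssSupportedInBall (u s) (R + s))
    {Φ : EuclideanSpace ℝ (Fin n) → ℝ} (hΦ : ContDiff ℝ ∞ Φ) (hΦc : HasCompactSupport Φ)
    (hΦr : ∀ x, ‖x‖ ≤ R + S → Φ =ᶠ[𝓝 x] fun y => Real.exp (y i)) :
    ∀ t ∈ Icc 0 S, Real.exp (-t) * (∫ x, ut t x * Φ x) +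
        ∫ s in (0 : ℝ)..t, (Real.exp (-s) * (∫ x, ut s x * Φ x) -
          Real.exp (-s) * ∫ x, u s x * Φ x) =
      (∫ x, u₁ x * Φ x) + ∫ s in (0 : ℝ)..t, Real.exp (-s) *
        ∫ x, glasseyNonlinearity n μ (ut s x) * Φ x := by
  intro t ht
  have hI : ∀ s ∈ Icc 0 S, s ∈ timeInterval T := fun s hs =>
    ⟨hs.1, lt_of_le_of_lt (by exact_mod_cast hs.2) hST⟩
  have hΦ2 : MemLp Φ 2 volume := hΦ.continuous.memLp_of_hasCompactSupport hΦc
  obtain ⟨T', hST', hT'T⟩ := EReal.lt_iff_exists_real_btwn.1 hST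
  have hST'' : S < T' := by exact_mod_cast hST'
  -- Equal to `1` up to time `(S + T') / 2 > S` and zero from `T' < T` on, hence admissible and
  -- invisible on `[0, S]`.
  let χ : ContDiffBump (S / 2) := ⟨T' / 2, T' - S / 2, by linarith, by linarith⟩
  have hχ1 : ∀ s ∈ Icc 0 S, χ =ᶠ[𝓝 s] 1 := fun s hs => by
    have hs' : Metric.ball (S / 2) (T' / 2) ∈ 𝓝 s := by
      refine Metric.isOpen_ball.mem_nhds ?_
      rw [Metric.mem_ball, Real.dist_eq, abs_lt]
      constructor <;> linarith [hs.1, hs.2]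
    filter_upwards [hs'] with r hr
    exact χ.one_of_mem_closedBall (Metric.ball_subset_closedBall hr)
  have hχ : ∀ s ∈ Icc 0 S, χ s = 1 := fun s hs => (hχ1 s hs).eq_of_nhds
  set φ : ℝ × EuclideanSpace ℝ (Fin n) → ℝ := fun z => χ z.1 * (Real.exp (-z.1) * Φ z.2) with hφ
  have hφs : ∀ s ∈ Icc 0 S, ∀ x, φ (s, x) = Real.exp (-s) * Φ x := fun s hs x => by
    simp only [hφ]; rw [hχ s hs, one_mul]
  have htest : IsSpaceTimeTest T φ := by
    refine ⟨?_, ?_, ?_⟩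
    · exact (χ.contDiff.comp contDiff_fst).mul
        (contDiff_fst.neg.exp.mul (hΦ.comp contDiff_snd))
    · refine HasCompactSupport.intro (χ.hasCompactSupport.isCompact.prod hΦc.isCompact) ?_
      rintro ⟨s, x⟩ hz
      rw [mem_prod, not_and_or] at hz
      rcases hz with hz | hz
      · simp only [hφ]; rw [image_eq_zero_of_notMem_tsupport hz, zero_mul]
      · simp only [hφ]; rw [image_eq_zero_of_notMem_tsupport hz, mul_zero, mul_zero]
    · intro z hz
      have hsub : tsupport φ ⊆ {z | z.1 ≤ T'} := by
        refine closure_minimal (fun z hz => ?_) (isClosed_le continuous_fst continuous_const)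
        have hz1 : χ z.1 ≠ 0 := fun h0 => hz (by simp only [hφ]; rw [h0, zero_mul])
        have hz2 : z.1 ∈ Metric.ball (S / 2) (T' - S / 2) := by
          rw [← χ.support_eq]; exact hz1
        rw [Metric.mem_ball, Real.dist_eq, abs_lt] at hz2
        change z.1 ≤ T'
        linarith [hz2.2]
      have hz' : z.1 ≤ T' := hsub hz
      exact lt_of_le_of_lt (by exact_mod_cast hz') hT'T
  have hrel := hsol.integral_relation φ htest t (hI t ht)
  have h1 : ∫ x, ut t x * φ (t, x) = Real.exp (-t) * ∫ x, ut t x * Φ x := by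
    rw [← integral_const_mul]
    refine integral_congr_ae (Eventually.of_forall fun x => ?_)
    simp only [hφs t ht]
    ring
  have h2 : ∫ x, u₁ x * φ (0, x) = ∫ x, u₁ x * Φ x := by
    refine integral_congr_ae (Eventually.of_forall fun x => ?_)
    simp only [hφs 0 (left_mem_Icc.2 hS)]
    simp
  have h3 : ∀ s ∈ Icc 0 S, ∫ x, glasseyNonlinearity n μ (ut s x) * φ (s, x) =
      Real.exp (-s) * ∫ x, glasseyNonlinearity n μ (ut s x) * Φ x := fun s hs => by
    rw [← integral_const_mul]
    refine integral_congr_ae (Eventually.of_forall fun x => ?_)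
    simp only [hφs s hs]
    ring
  have h4 : ∀ s ∈ Icc 0 S, ∀ x, deriv (fun r => φ (r, x)) s = -(Real.exp (-s) * Φ x) :=
    fun s hs x => by
    have heq : (fun r => φ (r, x)) =ᶠ[𝓝 s] fun r => Real.exp (-r) * Φ x := by
      filter_upwards [hχ1 s hs] with r hr
      simp only [hφ]
      rw [hr, Pi.one_apply, one_mul]
    rw [heq.deriv_eq]
    have := ((hasDerivAt_id s).neg.exp).mul_const (Φ x)
    refine this.deriv.trans ?_
    simp
  have h5 : ∀ s ∈ Icc 0 S, ∫ x, (inner ℝ (Du s x) (gradient (fun y => φ (s, y)) x)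
        - ut s x * deriv (fun r => φ (r, x)) s) =
      Real.exp (-s) * (∫ x, ut s x * Φ x) - Real.exp (-s) * ∫ x, u s x * Φ x := by
    intro s hs
    have hgr : (fun y => φ (s, y)) = fun y => Real.exp (-s) * Φ y := funext (hφs s hs)
    have hΨ : ContDiff ℝ ∞ fun y => Real.exp (-s) * Φ y := contDiff_const.mul hΦ
    have hΨc : HasCompactSupport fun y => Real.exp (-s) * Φ y := hΦc.mul_left
    have hu := hsol.continuous_u.1 s (hI s hs)
    have hut := hsol.continuous_ut.1 s (hI s hs)
    have hDu := hsol.continuous_Du.1 s (hI s hs)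
    have hgrad := (hsol.weakGradient s (hI s hs)).integral_inner_gradient_exp_coord i
      (c := Real.exp (-s)) hu hDu (hsupp s hs) hΨ hΨc (fun x hx => by
        filter_upwards [hΦr x (hx.trans (by linarith [hs.2]))] with y hy
        rw [hy])
    have hgc : Continuous (gradient fun y => Real.exp (-s) * Φ y) :=
      (InnerProductSpace.toDual ℝ _).symm.continuous.comp
        (hΨ.continuous_fderiv (by simp))
    have hgcs : HasCompactSupport (gradient fun y => Real.exp (-s) * Φ y) :=
      (hΨc.fderiv (𝕜 := ℝ)).comp_left (g := (InnerProductSpace.toDual ℝ _).symm) (map_zero _)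
    have hi1 : Integrable fun x =>
        inner ℝ (Du s x) (gradient (fun y => Real.exp (-s) * Φ y) x) :=
      (MemLp.integrable_mul_of_two hDu.norm
        (hgc.memLp_of_hasCompactSupport hgcs).norm).mono
        (hDu.1.inner hgc.aestronglyMeasurable) (Eventually.of_forall fun x => by
          rw [Real.norm_of_nonneg (mul_nonneg (norm_nonneg _) (norm_nonneg _))]
          exact norm_inner_le_norm _ _)
    have hi2 : Integrable fun x => ut s x * (-(Real.exp (-s) * Φ x)) :=
      MemLp.integrable_mul_of_two hut (hΦ2.const_mul _).neg
    have hexp : ∀ f : EuclideanSpace ℝ (Fin n) → ℝ,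
        ∫ x, f x * (Real.exp (-s) * Φ x) = Real.exp (-s) * ∫ x, f x * Φ x := fun f => by
      rw [← integral_const_mul]
      exact integral_congr_ae (Eventually.of_forall fun x => mul_left_comm _ _ _)
    simp_rw [h4 s hs, hgr]
    rw [integral_sub hi1 hi2, hgrad]
    simp_rw [mul_neg]
    rw [integral_neg, hexp, hexp]
    ring
  have hsub : ∀ s ∈ uIcc 0 t, s ∈ Icc 0 S := fun s hs => by
    rw [uIcc_of_le ht.1] at hs
    exact ⟨hs.1, hs.2.trans ht.2⟩
  rw [h1, h2, intervalIntegral.integral_congr fun s hs => h5 s (hsub s hs),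
    intervalIntegral.integral_congr fun s hs => h3 s (hsub s hs)] at hrel
  exact hrel

/-- Fubini on a compact cylinder; space-time integrability yields integrable slices only at almost
every time. -/
theorem IsEnergySolution.integrable_nonlinearity_mul {n : ℕ} {μ : ℝ → ℝ}
    {u₀ u₁ : EuclideanSpace ℝ (Fin n) → ℝ} {T : EReal}
    {u ut : ℝ → EuclideanSpace ℝ (Fin n) → ℝ}
    {Du : ℝ → EuclideanSpace ℝ (Fin n) → EuclideanSpace ℝ (Fin n)}
    (hsol : IsEnergySolution n μ u₀ u₁ T u ut Du) {S : ℝ} (hST : (S : EReal) < T)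
    {Φ : EuclideanSpace ℝ (Fin n) → ℝ} (hΦ : Continuous Φ) (hΦc : HasCompactSupport Φ) :
    IntegrableOn (fun s => Real.exp (-s) * ∫ x, glasseyNonlinearity n μ (ut s x) * Φ x)
        (Icc 0 S) ∧
      ∀ᵐ s, s ∈ Icc 0 S → Integrable fun x => glasseyNonlinearity n μ (ut s x) * Φ x := by
  have hK : IsCompact (Icc 0 S ×ˢ tsupport Φ) := isCompact_Icc.prod hΦc.isCompact
  have h1 : IntegrableOn (fun z : ℝ × EuclideanSpace ℝ (Fin n) =>
      glasseyNonlinearity n μ (ut z.1 z.2)) (Icc 0 S ×ˢ tsupport Φ) :=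
    hsol.locallyIntegrable.integrableOn_compact_subset (prod_mono (fun s hs =>
      ⟨hs.1, lt_of_le_of_lt (by exact_mod_cast hs.2) hST⟩) (subset_univ _)) hK
  have h2 : IntegrableOn (fun z : ℝ × EuclideanSpace ℝ (Fin n) =>
      glasseyNonlinearity n μ (ut z.1 z.2) * Φ z.2) (Icc 0 S ×ˢ tsupport Φ) :=
    h1.mul_continuousOn (hΦ.comp continuous_snd).continuousOn hK
  rw [IntegrableOn, Measure.volume_eq_prod, ← Measure.prod_restrict] at h2
  have hz : ∀ s, ∀ x ∉ tsupport Φ, glasseyNonlinearity n μ (ut s x) * Φ x = 0 := fun s x hx => by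
    rw [image_eq_zero_of_notMem_tsupport hx, mul_zero]
  constructor
  · have h3 := h2.integral_prod_left
    simp_rw [setIntegral_eq_integral_of_forall_compl_eq_zero (hz _)] at h3
    exact IntegrableOn.continuousOn_mul (by fun_prop) h3 isCompact_Icc
  · rw [← ae_restrict_iff' measurableSet_Icc]
    filter_upwards [h2.prod_right_ae] with s hs
    exact (integrableOn_iff_integrable_of_support_subset fun x hx => by
      by_contra hx'
      exact hx (hz s x hx')).1 hs

/-- Jensen for the weight `e ^ (-s) Φ` on the ball. It is applied to `|v|`, as convexity holds on
the half-line only; this can only raise the weighted mean. -/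
theorem ballMass_mul_le_integral {n : ℕ} (i : Fin n) {μ : ℝ → ℝ}
    (hμ : IsModulusOfContinuity μ) (hF : ConvexOn ℝ (Ici 0) (glasseyNonlinearity n μ))
    {R s U : ℝ} (hr : 0 < R + s) {v Φ : EuclideanSpace ℝ (Fin n) → ℝ} (hv : MemLp v 2 volume)
    (hvs : EssSupportedInBall v (R + s)) (hΦ : Continuous Φ) (hΦc : HasCompactSupport Φ)
    (hΦ0 : ∀ x, 0 ≤ Φ x) (hΦr : ∀ x, ‖x‖ ≤ R + s → Φ x = Real.exp (x i))
    (hint : Integrable fun x => glasseyNonlinearity n μ (v x) * Φ x) (hU0 : 0 < U)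
    (hU : U ≤ Real.exp (-s) * ∫ x, v x * Φ x) :
    ballMass n (2 * Real.exp R) (R + s) *
        glasseyNonlinearity n μ (U / ballMass n (2 * Real.exp R) (R + s)) ≤
      Real.exp (-s) * ∫ x, glasseyNonlinearity n μ (v x) * Φ x := by
  set B := Metric.closedBall (0 : EuclideanSpace ℝ (Fin n)) (R + s) with hB
  have hBm : MeasurableSet B := Metric.isClosed_closedBall.measurableSet
  have hmem : ∀ x, x ∈ B ↔ ‖x‖ ≤ R + s := fun x => by simp [hB]
  have hΦ2 : MemLp Φ 2 volume := hΦ.memLp_of_hasCompactSupport hΦc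
  have hvΦ : Integrable fun x => v x * Φ x := MemLp.integrable_mul_of_two hv hΦ2
  have hvΦ' : Integrable fun x => |v x| * (Real.exp (-s) * Φ x) :=
    MemLp.integrable_mul_of_two hv.abs (hΦ2.const_mul _)
  have hFint : Integrable fun x =>
      glasseyNonlinearity n μ |v x| * (Real.exp (-s) * Φ x) := by
    refine (hint.const_mul (Real.exp (-s))).congr (Eventually.of_forall fun x => ?_)
    simp only [glasseyNonlinearity_abs]
    ring
  have hM := ballMass_pos (n := n) (A := 2 * Real.exp R) (by positivity) hr
  have hJ := hF.mul_map_div_le_setIntegral (ν := volume) hBm (glasseyNonlinearity_zero hμ)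
    (fun τ _ => glasseyNonlinearity_nonneg hμ τ) (v := fun x => |v x|)
    (w := fun x => Real.exp (-s) * Φ x) (fun x => abs_nonneg _)
    (fun x => mul_nonneg (Real.exp_pos _).le (hΦ0 x))
    ((hΦ.integrable_of_hasCompactSupport hΦc).const_mul _).integrableOn
    hvΦ'.integrableOn hFint.integrableOn hM hU0 ?_ ?_
  · refine hJ.trans ?_
    refine (setIntegral_le_integral hFint (Eventually.of_forall fun x =>
      mul_nonneg (glasseyNonlinearity_nonneg hμ _)
        (mul_nonneg (Real.exp_pos _).le (hΦ0 x)))).trans_eq ?_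
    rw [← integral_const_mul]
    refine integral_congr_ae (Eventually.of_forall fun x => ?_)
    simp only [glasseyNonlinearity_abs]
    ring
  · rw [integral_const_mul, setIntegral_congr_fun hBm fun x hx => hΦr x ((hmem x).1 hx)]
    calc Real.exp (-s) * ∫ x in B, Real.exp (x i)
        ≤ Real.exp (-s) * (2 * Real.exp (R + s) * √(4 * Real.pi * (R + s)) ^ (n - 1)) :=
          mul_le_mul_of_nonneg_left (integral_exp_coord_closedBall_le i hr) (Real.exp_pos _).le
      _ = ballMass n (2 * Real.exp R) (R + s) := by
          -- The decay `e ^ (-s)` cancels the growth `e ^ (R + s)`, which explains the constant `2 *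
          -- e ^ R`.
          have : Real.exp R = Real.exp (-s) * Real.exp (R + s) := by
            rw [← Real.exp_add]; ring_nf
          rw [ballMass, this]; ring
  · refine hU.trans ?_
    rw [← integral_const_mul, setIntegral_eq_integral_of_ae_compl_eq_zero]
    · refine integral_mono (hvΦ.const_mul _) hvΦ' fun x => ?_
      have := mul_le_mul_of_nonneg_right (le_abs_self (v x))
        (mul_nonneg (Real.exp_pos (-s)).le (hΦ0 x))
      simp only
      linarith
    · filter_upwards [hvs] with x hx hxB
      rw [hmem, not_le] at hxB
      rw [hx hxB, abs_zero, zero_mul]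

/-! ### Positivity of the data and conclusion -/

theorem integral_mul_congr_of_essSupportedInBall {n : ℕ} {f g k : EuclideanSpace ℝ (Fin n) → ℝ}
    {r : ℝ} (hf : EssSupportedInBall f r) (hgk : ∀ x, ‖x‖ ≤ r → g x = k x) :
    (fun x => f x * g x) =ᵐ[volume] fun x => f x * k x := by
  filter_upwards [hf] with x hx
  rcases le_or_gt ‖x‖ r with h | h
  · rw [hgk x h]
  · simp [hx h]

theorem integral_mul_exp_coord_pos {n : ℕ} (i : Fin n) {R : ℝ} (hR : 0 < R)
    {f : EuclideanSpace ℝ (Fin n) → ℝ} (hf : MemLp f 2 volume) (hf0 : 0 ≤ᵐ[volume] f)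
    (hfR : EssSupportedInBall f R) (hne : ¬ f =ᵐ[volume] 0) :
    0 < ∫ x, f x * Real.exp (x i) := by
  obtain ⟨Φ, hΦ, hΦc, -, hΦr⟩ := exists_contDiff_eventuallyEq_exp_coord i hR
  have hint : Integrable fun x => f x * Real.exp (x i) :=
    (MemLp.integrable_mul_of_two hf (hΦ.continuous.memLp_of_hasCompactSupport hΦc)).congr
      (integral_mul_congr_of_essSupportedInBall hfR fun x hx => (hΦr x hx).eq_of_nhds)
  have hnn : 0 ≤ᵐ[volume] fun x => f x * Real.exp (x i) := by
    filter_upwards [hf0] with x hx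
    exact mul_nonneg hx (Real.exp_pos _).le
  refine lt_of_le_of_ne (integral_nonneg_of_ae hnn) fun h0 => hne ?_
  filter_upwards [(integral_eq_zero_iff_of_nonneg_ae hnn hint).1 h0.symm] with x hx
  exact (mul_eq_zero.1 hx).resolve_right (Real.exp_pos _).ne'

theorem mainTheorem1 (n : ℕ) (hn : 2 ≤ n)
    (μ : ℝ → ℝ) (hμ : IsModulusOfContinuity μ)
    (C : EReal) (hC : 0 < C)
    (hlim : Tendsto (fun τ : ℝ => ((μ τ * Real.log (1 / τ) : ℝ) : EReal)) (𝓝[>] 0) (𝓝 C))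
    (hmono : C ≠ ⊤ →
      ∃ τ₀ : ℝ, 0 < τ₀ ∧ MonotoneOn (fun τ : ℝ => μ τ * Real.log (1 / τ)) (Ioc 0 τ₀))
    (hconv : ConvexOn ℝ (Ici 0) (fun τ : ℝ => τ * μ τ ^ (1 / glasseyExponent n)))
    (R : ℝ) (hR : 0 < R)
    (u₀ u₁ : EuclideanSpace ℝ (Fin n) → ℝ)
    (hu₀ : MemH1 u₀) (hu₁ : MemLp u₁ 2 volume)
    (hu₀_nonneg : 0 ≤ᵐ[volume] u₀) (hu₁_nonneg : 0 ≤ᵐ[volume] u₁)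
    (hu₀_supp : EssSupportedInBall u₀ R) (hu₁_supp : EssSupportedInBall u₁ R)
    (hu₁_ne : ¬ u₁ =ᵐ[volume] 0) :
    ∃ Tmax : ℝ, ∀ (T : EReal) (u ut : ℝ → EuclideanSpace ℝ (Fin n) → ℝ)
      (Du : ℝ → EuclideanSpace ℝ (Fin n) → EuclideanSpace ℝ (Fin n)),
      0 < T →
      IsEnergySolution n μ u₀ u₁ T u ut Du →
      (∀ t ∈ timeInterval T, 0 < t → EssSupportedInBall (u t) (R + t)) →
      T ≤ (Tmax : EReal) := by
  let i : Fin n := ⟨0, by omega⟩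
  have hF := convexOn_glasseyNonlinearity hn hμ hconv
  -- The exact exponential is used, not a truncation, so that the lifespan bound is independent of
  -- `S` and of the solution.
  set a := ∫ x, u₁ x * Real.exp (x i) with ha
  have ha0 : 0 < a := integral_mul_exp_coord_pos i hR hu₁ hu₁_nonneg hu₁_supp hu₁_ne
  obtain ⟨Tmax, hTmax⟩ := exists_lifespan_bound hn hμ hC hlim
    (A := 2 * Real.exp R) (b := a / 2) (R := R) (by positivity) (by positivity) hR
  refine ⟨max Tmax 0, fun T u ut Du _ hsol hsupp => ?_⟩
  by_contra! hlt
  obtain ⟨S, hS1, hST⟩ := EReal.lt_iff_exists_real_btwn.1 hlt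
  have hS1' : max Tmax 0 < S := by exact_mod_cast hS1
  have hS : 0 ≤ S := (le_max_right _ _).trans hS1'.le
  refine absurd ?_ (not_le.2 ((le_max_left Tmax 0).trans_lt hS1'))
  have hI : Icc 0 S ⊆ timeInterval T := fun s hs =>
    ⟨hs.1, lt_of_le_of_lt (by exact_mod_cast hs.2) hST⟩
  obtain ⟨Φ, hΦ, hΦc, hΦ0, hΦr⟩ :=
    exists_contDiff_eventuallyEq_exp_coord i (by linarith : 0 < R + S)
  have hΦ2 : MemLp Φ 2 volume := hΦ.continuous.memLp_of_hasCompactSupport hΦc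
  have hsupp' : ∀ s ∈ Icc 0 S, EssSupportedInBall (u s) (R + s) := fun s hs => by
    -- The support condition is given for positive times; at time `0` it comes from the data.
    rcases hs.1.eq_or_lt with rfl | h0
    · filter_upwards [hsol.initial, hu₀_supp] with x hx hx' hxR
      rw [hx, hx' (by linarith)]
    · exact hsupp s (hI hs) h0
  have hid := hsol.integral_identity i hS hST hsupp' hΦ hΦc hΦr
  have haΦ : ∫ x, u₁ x * Φ x = a :=
    integral_congr_ae (integral_mul_congr_of_essSupportedInBall hu₁_supp fun x hx =>
      (hΦr x (by linarith)).eq_of_nhds)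
  rw [haΦ] at hid
  obtain ⟨hhint, hae⟩ := hsol.integrable_nonlinearity_mul hST hΦ.continuous hΦc
  have hhint' := (intervalIntegrable_iff_integrableOn_Icc_of_le hS).2 hhint
  have hh0 : ∀ s : ℝ, 0 ≤ s →
      0 ≤ Real.exp (-s) * ∫ x, glasseyNonlinearity n μ (ut s x) * Φ x := fun s _ =>
    mul_nonneg (Real.exp_pos _).le (integral_nonneg fun x =>
      mul_nonneg (glasseyNonlinearity_nonneg hμ _) (hΦ0 x))
  have hexpc : Continuous fun s : ℝ => Real.exp (-s) := by fun_prop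
  have hUc : ContinuousOn (fun s => Real.exp (-s) * ∫ x, ut s x * Φ x) (Icc 0 S) :=
    hexpc.continuousOn.mul ((hsol.continuous_ut.continuousOn_integral_mul hΦ2).mono hI)
  have hVc : ContinuousOn (fun s => Real.exp (-s) * ∫ x, u s x * Φ x) (Icc 0 S) :=
    hexpc.continuousOn.mul ((hsol.continuous_u.continuousOn_integral_mul hΦ2).mono hI)
  have hlow := half_le_of_integral_identity ha0.le
    (V := fun s => Real.exp (-s) * ∫ x, u s x * Φ x)
    (mul_nonneg (Real.exp_pos _).le (integral_nonneg_of_ae (by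
      filter_upwards [hsol.initial, hu₀_nonneg] with x hx hx'
      rw [hx]
      exact mul_nonneg hx' (hΦ0 x)))) hhint' hh0 hUc hVc (fun s hs => by
      have h1 := (hsol.timeDeriv.hasDerivWithinAt_integral_mul hsol.continuous_u.1
        hsol.continuous_ut.1 hΦ2 (hI (Ioo_subset_Icc_self hs))).hasDerivAt
        (mem_of_superset (Icc_mem_nhds hs.1 hs.2) hI)
      refine ((hasDerivAt_id s).neg.exp.mul h1).congr_deriv ?_
      simp only [id, Pi.neg_apply]
      ring) hid
  refine hTmax S _ _ hS hhint' hh0 hlow ?_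
  filter_upwards [hae] with s hs hsS
  have hsS' : s ∈ Icc 0 S := Ioc_subset_Icc_self hsS
  have hut := hsol.continuous_ut.1 s (hI hsS')
  refine ballMass_mul_le_integral i hμ hF (by linarith [hsS.1]) hut
    (hsol.timeDeriv.essSupportedInBall ((Icc_subset_Icc_right hsS.2).trans hI) hsS.1 hut
      fun r hr => hsupp' r ⟨hr.1.le, hr.2.trans hsS.2⟩) hΦ.continuous hΦc hΦ0
    (fun x hx => (hΦr x (by linarith [hsS.2])).eq_of_nhds) (hs hsS') ?_ le_rfl
  have h1 := hlow s hsS'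
  have h2 : 0 ≤ ∫ r in (0 : ℝ)..s,
      Real.exp (-r) * ∫ x, glasseyNonlinearity n μ (ut r x) * Φ x :=
    intervalIntegral.integral_nonneg hsS.1.le fun r hr => hh0 r hr.1
  linarith
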